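/- Let $\mathbb R^{2,1}$ be $\mathbb R^3$ with the Lorentzian product $\langle (x,y,z),(x',y',z')\rangle = xx'+yy'-zz'$, and for $\theta\in\mathbb S^1=\mathbb R/2\pi\mathbb Z$ put $\vec\theta=(\cos\theta,\sin\theta,1)$. Let $\Sigma\subset\mathbb R^{2,1}$ be a convex entire spacelike surface of class $C^2$: no two points of $\Sigma$ are timelike separated, $\Sigma$ meets every timelike line exactly once, $\Sigma$ is the graph $z=f(x,y)$ of a convex function, and $\Sigma$ is locally the graph of a $C^2$ function $g$ with $\|Dg\|<1$. Its null support function is $\phi(\theta)=\sup_{p\in\Sigma}\langle p,\vec\theta\rangle\in\mathbb R\cup\{+\infty\}$. Let $0<T\le\infty$ and let $\gamma:[0,T)\to\Sigma$ be an (affinely parametrized) geodesic of the induced Riemannian metric which is proper as a map to $\Sigma$ and has finite length. Then there is $\theta_+\in\mathbb S^1$ such that: 1. $\dot\gamma(t)$ converges projectively to $\vec\theta_+$ as $t\to T$ (that is, the lines $\mathbb R\dot\gamma(t)$ converge to the line $\mathbb R\vec\theta_+$ in the projective space of $\mathbb R^{2,1}$), and $\theta_+$ is the only element of $\mathbb S^1$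 with this property; 2. there is a unique null line $L=\{x+r\vec\theta_+ : r\in\mathbb R\}$ to which $\gamma$ is asymptotic, that is, such that the image of $\gamma(t)$ in the quotient $\mathbb R^{2,1}/\mathbb R\vec\theta_+$ converges, as $t\to T$, to the point corresponding to $L$; 3. $\langle\gamma(t),\vec\theta_+\rangle\to\phi(\theta_+)$ as $t\to T$, and $\phi(\theta_+)<\infty$; 4. $\langle\gamma(t),\vec\theta\rangle\to-\infty$ as $t\to T$ for every $\theta\in\mathbb S^1$ with $\theta\ne\theta_+$. -/

import Mathlib

open Filter Topology MeasureTheory Set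

noncomputable section

namespace Minkowski

/-- The Euclidean plane `ℝ²`. -/
abbrev Plane : Type := EuclideanSpace ℝ (Fin 2)

/-- The vector space `ℝ^{2,1}`, split as `ℝ² × ℝ`: the point `(x, y, z)` is `((x, y), z)`. -/
abbrev Space : Type := Plane × ℝ

/-- The Lorentzian product `⟨(x,y,z), (x',y',z')⟩ = x x' + y y' - z z'`. -/
def form (p q : Space) : ℝ := p.1 0 * q.1 0 + p.1 1 * q.1 1 - p.2 * q.2

/-- A vector `v` is timelike if `⟨v, v⟩ < 0`. -/
def IsTimelike (v : Space) : Prop := form v v < 0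

/-- The future-directed null vector `(cos θ, sin θ, 1)`, for `θ ∈ ℝ / 2πℤ`. -/
def nullVec (θ : Real.Angle) : Space := (!₂[θ.cos, θ.sin], 1)

/-- The affine null line `{x + r (cos θ, sin θ, 1) | r ∈ ℝ}`. -/
def nullLine (x : Space) (θ : Real.Angle) : AffineSubspace ℝ Space :=
  AffineSubspace.mk' x (Submodule.span ℝ {nullVec θ})

/-- The graph of a function over a subset `D` of the horizontal plane. -/
def graphOn (f : Plane → ℝ) (D : Set Plane) : Set Space := {p | p.1 ∈ D ∧ p.2 = f p.1}

/-- A set is achronal if no two of its points are timelike separated. -/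
def IsAchronal (S : Set Space) : Prop := ∀ p ∈ S, ∀ q ∈ S, ¬ IsTimelike (q - p)

/-- An achronal set is entire if it meets every timelike line exactly once. -/
def IsEntire (S : Set Space) : Prop :=
  IsAchronal S ∧ ∀ p v : Space, IsTimelike v → ∃! q : Space, q ∈ S ∧ ∃ r : ℝ, q = p + r • v

/-- A surface is convex if it is the graph of a convex function on a (convex) subset of the
horizontal plane. -/
def IsConvexSurface (S : Set Space) : Prop :=
  ∃ (D : Set Plane) (f : Plane → ℝ), ConvexOn ℝ D f ∧ S = graphOn f D

/-- A `C²` surface is spacelike if it is locally the graph, over an open subset of the horizontal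
plane, of a `C²` function `f` with `‖Df‖ < 1`. -/
def IsSpacelike (S : Set Space) : Prop :=
  ∀ p ∈ S, ∃ (W : Set Space) (U : Set Plane) (f : Plane → ℝ),
    IsOpen W ∧ p ∈ W ∧ IsOpen U ∧ ContDiffOn ℝ 2 f U ∧ (∀ x ∈ U, ‖fderiv ℝ f x‖ < 1) ∧
      S ∩ W = graphOn f U ∩ W

/-- Convex entire spacelike surfaces (of class `C²`) in Minkowski space. -/
structure IsConvexEntireSpacelike (S : Set Space) : Prop where
  isEntire : IsEntire S
  isConvexSurface : IsConvexSurface S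
  isSpacelike : IsSpacelike S

/-- `v` is tangent to `S` at `p`: it is the velocity at `p` of a curve in `S`. -/
def IsTangent (S : Set Space) (p v : Space) : Prop :=
  ∃ c : ℝ → Space, c 0 = p ∧ (∀ᶠ s in 𝓝 (0 : ℝ), c s ∈ S) ∧ HasDerivAt c v 0

/-- The interval `[0, T)`, where `T` may be infinite. -/
def ray (T : EReal) : Set ℝ := {t | 0 ≤ t ∧ (t : EReal) < T}

/-- The filter `t → T` from the left on the real line, where `T` may be infinite. -/
def toEnd (T : EReal) : Filter ℝ := comap ((↑) : ℝ → EReal) (𝓝[<] T)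

/-- The velocity of a curve on `[0, T)`; it is one-sided at `0`. -/
def velocity (γ : ℝ → Space) (T : EReal) : ℝ → Space := derivWithin γ (ray T)

/-- The acceleration of a curve on `[0, T)` in the ambient vector space. -/
def acceleration (γ : ℝ → Space) (T : EReal) : ℝ → Space := derivWithin (velocity γ T) (ray T)

/-- `γ : [0, T) → S` is an (affinely parametrized) geodesic of the induced metric: the covariant
derivative of its velocity, which is the part of the ambient acceleration tangent to `S`, is zero,
that is, the acceleration is orthogonal to `S`. Only the values of `γ` on `[0, T)` matter. -/
structure IsGeodesic (S : Set Space) (T : EReal) (γ : ℝ → Space) : Prop where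
  mapsTo : MapsTo γ (ray T) S
  contDiffOn : ContDiffOn ℝ 2 γ (ray T)
  acceleration_normal :
    ∀ t ∈ ray T, ∀ v, IsTangent S (γ t) v → form (acceleration γ T t) v = 0

/-- The Lorentzian length of a spacelike curve on `[0, T)`. -/
def length (T : EReal) (γ : ℝ → Space) : ENNReal :=
  ∫⁻ t in ray T, ENNReal.ofReal (Real.sqrt (form (velocity γ T t) (velocity γ T t)))

/-- The null support function `φ(θ) = sup_{p ∈ S} ⟨p, (cos θ, sin θ, 1)⟩`, which may be `+∞`. -/
def nullSupport (S : Set Space) (θ : Real.Angle) : EReal :=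
  ⨆ p ∈ S, ((form p (nullVec θ) : ℝ) : EReal)

/-- The vectors `v t` converge projectively to `w ≠ 0`, that is, the lines `ℝ v` converge to the
line `ℝ w` in the projective space, which is the quotient of the nonzero vectors by scaling: every
open set of nonzero vectors which is stable under nonzero scalars and contains `w` eventually
contains `v t`. -/
def ConvergesProjectively (v : ℝ → Space) (l : Filter ℝ) (w : Space) : Prop :=
  ∀ U : Set Space, IsOpen U → (0 : Space) ∉ U → (∀ a : ℝ, a ≠ 0 → ∀ u ∈ U, a • u ∈ U) → w ∈ U →
    ∀ᶠ t in l, v t ∈ U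

/-- A curve is asymptotic to an affine subspace `V` with direction `TV` if it converges, in the
quotient by `TV`, to the point which corresponds to `V`. -/
def IsAsymptoticTo (γ : ℝ → Space) (l : Filter ℝ) (V : AffineSubspace ℝ Space) : Prop :=
  ∃ x ∈ V, Tendsto (fun t => V.direction.mkQ (γ t)) l (𝓝 (V.direction.mkQ x))

end Minkowski

end

/-! The surface is the graph of a convex function `f` on the whole plane with `‖Df‖ < 1`. The
acceleration of a geodesic is orthogonal to a spacelike plane, hence causal, and convexity makes it
future directed (`IsGeodesic.acceleration_causal`). The speed is a constant, positive because a
proper curve is not constant, so finite length forces `T` to be finite.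

Increments of the velocity are now future causal. The vertical velocity `r` is therefore monotone;
if it were bounded, the curve would converge at the finite time `T`, against properness. So `r`
tends to infinity. As the Lorentzian square stays equal to `c`, the velocity divided by `r`
approaches the null cone. Any two velocities have product at least `c > 0`, so a cluster point `θ`
of the direction has nonnegative product with every velocity, and this forces convergence to `θ`
(`exists_angle`).

In coordinates adapted to `θ`, the null height and the transverse coordinate have bounded
derivatives near the finite time `T`, hence converge, while `z` tends to infinity
(`exists_angle_asymptotics`). This gives the asymptotic null line and the limit `-∞` in the other
null directions. Achronality bounds the null height of every point of the surface by the limit,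
which is thus the supremum. -/

namespace Minkowski

/-! ### Calculus in one variable. -/

/-- A function with bounded derivative on `[a, b)` has a limit at `b`. -/
theorem exists_tendsto_nhdsLT_of_abs_deriv_le {a b C : ℝ} {g g' : ℝ → ℝ} (hab : a < b)
    (hg : ∀ t ∈ Ico a b, HasDerivAt g (g' t) t) (hC : ∀ t ∈ Ico a b, |g' t| ≤ C) :
    ∃ l, Tendsto g (𝓝[<] b) (𝓝 l) := by
  have hC0 : 0 ≤ C := (abs_nonneg _).trans (hC a ⟨le_rfl, hab⟩)
  lift C to NNReal using hC0
  have hlip : LipschitzOnWith C g (Ico a b) :=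
    (convex_Ico a b).lipschitzOnWith_of_nnnorm_hasDerivWithin_le
      (fun t ht => (hg t ht).hasDerivWithinAt) (fun t ht => by
        rw [← NNReal.coe_le_coe]; simpa using hC t ht)
  obtain ⟨G, hG, hEq⟩ := hlip.extend_real
  refine ⟨G b, ((hG.continuous.tendsto b).mono_left nhdsWithin_le_nhds).congr' ?_⟩
  filter_upwards [Ico_mem_nhdsLT hab] with t ht using (hEq ht).symm

theorem exists_angle_of_sq_add_sq_eq_one {a b : ℝ} (h : a ^ 2 + b ^ 2 = 1) :
    ∃ θ : Real.Angle, θ.cos = a ∧ θ.sin = b := by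
  have h1 : ‖(⟨a, b⟩ : ℂ)‖ = 1 := by
    rw [Complex.norm_eq_sqrt_sq_add_sq, h, Real.sqrt_one]
  obtain ⟨θ, hθ⟩ := (Complex.norm_eq_one_iff _).1 h1
  refine ⟨θ, ?_, ?_⟩
  · have := congrArg Complex.re hθ
    simpa [Complex.exp_ofReal_mul_I_re] using this
  · have := congrArg Complex.im hθ
    simpa [Complex.exp_ofReal_mul_I_im] using this

/-- At a local minimum the second derivative is nonnegative. -/
theorem second_deriv_nonneg_of_isLocalMin {h h' : ℝ → ℝ} {h'' t : ℝ} (hmin : IsLocalMin h t)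
    (h1 : ∀ᶠ s in 𝓝 t, HasDerivAt h (h' s) s) (h2 : HasDerivAt h' h'' t) : 0 ≤ h'' := by
  have hd : deriv h =ᶠ[𝓝 t] h' := h1.mono fun s hs => hs.deriv
  have hdd : deriv (deriv h) t = h'' := by rw [hd.deriv_eq, h2.deriv]
  by_contra! hneg
  -- A negative second derivative would make `t` a local maximum too, so `h` would be constant near
  -- `t` and the second derivative zero.
  have hmax : IsLocalMax h t := isLocalMax_of_deriv_deriv_neg (by rwa [hdd]) hmin.deriv_eq_zero
    h1.self_of_nhds.continuousAt
  have hc : h =ᶠ[𝓝 t] fun _ => h t := by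
    filter_upwards [hmin, hmax] with s hs hs' using le_antisymm hs' hs
  have : deriv (deriv h) t = 0 := by
    rw [hc.deriv.deriv_eq]; simp
  linarith

/-! ### Curves with future causal acceleration. -/

/-- The curve `(x, y, z)` on `(0, τ)` has velocity `(p, q, r)` of constant Lorentzian square `c`, and
its acceleration `(p', q', r')` lies in the closed future cone. -/
structure IsFutureAccelerated (τ c : ℝ) (x y z p q r p' q' r' : ℝ → ℝ) : Prop where
  hx : ∀ t ∈ Ioo 0 τ, HasDerivAt x (p t) t
  hy : ∀ t ∈ Ioo 0 τ, HasDerivAt y (q t) t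
  hz : ∀ t ∈ Ioo 0 τ, HasDerivAt z (r t) t
  hp : ∀ t ∈ Ioo 0 τ, HasDerivAt p (p' t) t
  hq : ∀ t ∈ Ioo 0 τ, HasDerivAt q (q' t) t
  hr : ∀ t ∈ Ioo 0 τ, HasDerivAt r (r' t) t
  nonneg : ∀ t ∈ Ioo 0 τ, 0 ≤ r' t
  cone : ∀ t ∈ Ioo 0 τ, p' t ^ 2 + q' t ^ 2 ≤ r' t ^ 2
  speed : ∀ t ∈ Ioo 0 τ, p t ^ 2 + q t ^ 2 - r t ^ 2 = c

namespace IsFutureAccelerated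

variable {τ c : ℝ} {x y z p q r p' q' r' : ℝ → ℝ}

/-- The product of the velocity with a fixed past causal vector is antitone. -/
theorem antitoneOn (h : IsFutureAccelerated τ c x y z p q r p' q' r') {a b d : ℝ} (hd : 0 ≤ d)
    (hab : a ^ 2 + b ^ 2 ≤ d ^ 2) :
    AntitoneOn (fun t => a * p t + b * q t - d * r t) (Ioo 0 τ) := by
  have hD : ∀ t ∈ Ioo 0 τ, HasDerivAt (fun t => a * p t + b * q t - d * r t)
      (a * p' t + b * q' t - d * r' t) t := fun t ht =>
    (((h.hp t ht).const_mul a).add ((h.hq t ht).const_mul b)).sub ((h.hr t ht).const_mul d)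
  refine antitoneOn_of_deriv_nonpos (convex_Ioo 0 τ)
    (fun t ht => (hD t ht).continuousAt.continuousWithinAt) ?_ ?_
  · rw [interior_Ioo]
    exact fun t ht => (hD t ht).differentiableAt.differentiableWithinAt
  · rw [interior_Ioo]
    intro t ht
    rw [(hD t ht).deriv, sub_nonpos]
    refine abs_le_of_sq_le_sq' ?_ (mul_nonneg hd (h.nonneg t ht)) |>.2
    calc (a * p' t + b * q' t) ^ 2 ≤ (a ^ 2 + b ^ 2) * (p' t ^ 2 + q' t ^ 2) := by
          nlinarith [sq_nonneg (a * q' t - b * p' t)]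
      _ ≤ d ^ 2 * r' t ^ 2 := mul_le_mul hab (h.cone t ht) (by positivity) (by positivity)
      _ = _ := by ring

theorem monotoneOn (h : IsFutureAccelerated τ c x y z p q r p' q' r') :
    MonotoneOn r (Ioo 0 τ) := fun s hs t ht hst => by
  have := h.antitoneOn (a := 0) (b := 0) (d := 1) (by norm_num) (by norm_num) hs ht hst
  simpa using this

/-- Two velocities have Lorentzian product at least `c`. -/
theorem le_form_velocity (h : IsFutureAccelerated τ c x y z p q r p' q' r') {s t : ℝ}
    (hs : s ∈ Ioo 0 τ) (ht : t ∈ Ioo 0 τ) (hst : s ≤ t) :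
    c ≤ p t * p s + q t * q s - r t * r s := by
  have hmono := h.monotoneOn hs ht hst
  set d := Real.sqrt ((p t - p s) ^ 2 + (q t - q s) ^ 2) with hd
  have hd2 : d ^ 2 = (p t - p s) ^ 2 + (q t - q s) ^ 2 := Real.sq_sqrt (by positivity)
  have hd0 : 0 ≤ d := Real.sqrt_nonneg _
  -- Testing against the null vector over the horizontal increment shows that the velocity increment
  -- is future causal. Its Lorentzian square, `2c` minus twice the product, is then nonpositive.
  have h0 := h.antitoneOn (a := p t - p s) (b := q t - q s) (d := d) hd0 hd2.ge hs ht hst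
  simp only at h0
  have h1 : d * d ≤ d * (r t - r s) := by nlinarith
  have h2 : d ≤ r t - r s := by
    rcases hd0.eq_or_lt with h0 | h0
    · linarith
    · exact le_of_mul_le_mul_left h1 h0
  have h3 : d ^ 2 ≤ (r t - r s) ^ 2 := by gcongr
  nlinarith [h.speed s hs, h.speed t ht]

/-- If the curve leaves every compact set then its vertical velocity tends to infinity. -/
theorem tendsto_atTop (h : IsFutureAccelerated τ c x y z p q r p' q' r') (hτ : 0 < τ)
    (hproper : Tendsto (fun t => x t ^ 2 + y t ^ 2 + z t ^ 2) (𝓝[<] τ) atTop) :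
    Tendsto r (𝓝[<] τ) atTop := by
  have hunb : ∀ M, ∃ t ∈ Ioo 0 τ, M < r t := by
    by_contra! hM
    obtain ⟨M, hM⟩ := hM
    have hmid : τ / 2 ∈ Ioo 0 τ := ⟨by linarith, by linarith⟩
    have hsub : Ico (τ / 2) τ ⊆ Ioo 0 τ := fun t ht => ⟨hmid.1.trans_le ht.1, ht.2⟩
    -- `M` bounds `r` above only; the lower bound is the midpoint value, by monotonicity. With the
    -- speed fixed, all components of the velocity are then bounded.
    set B := max |M| |r (τ / 2)| with hB
    have hrB : ∀ t ∈ Ico (τ / 2) τ, |r t| ≤ B := fun t ht => by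
      have h1 := hM t (hsub ht)
      have h2 := h.monotoneOn hmid (hsub ht) ht.1
      rw [abs_le]
      exact ⟨by linarith [neg_abs_le (r (τ / 2)), le_max_right |M| |r (τ / 2)|],
        by linarith [le_abs_self M, le_max_left |M| |r (τ / 2)|]⟩
    have hpq : ∀ t ∈ Ico (τ / 2) τ, p t ^ 2 + q t ^ 2 ≤ B ^ 2 + c := fun t ht => by
      have h1 := h.speed t (hsub ht)
      have h2 := sq_le_sq' (abs_le.1 (hrB t ht)).1 (abs_le.1 (hrB t ht)).2
      linarith
    obtain ⟨a, ha⟩ := exists_tendsto_nhdsLT_of_abs_deriv_le (by linarith : τ / 2 < τ)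
      (fun t ht => h.hx t (hsub ht)) (C := Real.sqrt (B ^ 2 + c)) (fun t ht =>
        Real.abs_le_sqrt (by nlinarith [hpq t ht, sq_nonneg (q t)]))
    obtain ⟨b, hb⟩ := exists_tendsto_nhdsLT_of_abs_deriv_le (by linarith : τ / 2 < τ)
      (fun t ht => h.hy t (hsub ht)) (C := Real.sqrt (B ^ 2 + c)) (fun t ht =>
        Real.abs_le_sqrt (by nlinarith [hpq t ht, sq_nonneg (p t)]))
    obtain ⟨d, hd⟩ := exists_tendsto_nhdsLT_of_abs_deriv_le (by linarith : τ / 2 < τ)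
      (fun t ht => h.hz t (hsub ht)) hrB
    exact not_tendsto_nhds_of_tendsto_atTop hproper _ (((ha.pow 2).add (hb.pow 2)).add (hd.pow 2))
  refine Filter.tendsto_atTop.2 fun M => ?_
  obtain ⟨s, hs, hsM⟩ := hunb M
  filter_upwards [Ico_mem_nhdsLT hs.2] with t ht
  exact hsM.le.trans (h.monotoneOn hs ⟨hs.1.trans_le ht.1, ht.2⟩ ht.1)

/-- If the vertical velocity tends to infinity then the velocity has a projective limit. -/
theorem exists_angle (h : IsFutureAccelerated τ c x y z p q r p' q' r') (hτ : 0 < τ) (hc : 0 < c)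
    (hrtop : Tendsto r (𝓝[<] τ) atTop) :
    ∃ θ : Real.Angle, (∀ s ∈ Ioo 0 τ, 0 ≤ p s * θ.cos + q s * θ.sin - r s) ∧
      Tendsto (fun t => p t / r t) (𝓝[<] τ) (𝓝 θ.cos) ∧
      Tendsto (fun t => q t / r t) (𝓝[<] τ) (𝓝 θ.sin) := by
  have hIoo : ∀ᶠ t in 𝓝[<] τ, t ∈ Ioo 0 τ := Ioo_mem_nhdsLT hτ
  have hrpos : ∀ᶠ t in 𝓝[<] τ, 1 ≤ r t := hrtop.eventually_ge_atTop 1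
  have hinv : Tendsto (fun t => (r t)⁻¹) (𝓝[<] τ) (𝓝 0) := tendsto_inv_atTop_zero.comp hrtop
  have hnorm : Tendsto (fun t => (p t / r t) ^ 2 + (q t / r t) ^ 2) (𝓝[<] τ) (𝓝 1) := by
    have : Tendsto (fun t => 1 + c * (r t)⁻¹ ^ 2) (𝓝[<] τ) (𝓝 (1 + c * 0 ^ 2)) :=
      ((hinv.pow 2).const_mul c).const_add 1
    rw [show (1 + c * 0 ^ 2 : ℝ) = 1 by ring] at this
    refine this.congr' ?_
    filter_upwards [hIoo, hrpos] with t ht ht1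
    have := h.speed t ht
    have h0 : r t ≠ 0 := by linarith
    field_simp
    linarith
  obtain ⟨e, -, he⟩ : ∃ e ∈ Icc (-2 : ℝ) 2 ×ˢ Icc (-2 : ℝ) 2,
      MapClusterPt e (𝓝[<] τ) (fun t => (p t / r t, q t / r t)) := by
    refine (isCompact_Icc.prod isCompact_Icc).exists_mapClusterPt (tendsto_principal.2 ?_)
    filter_upwards [hnorm.eventually_le_const (by norm_num : (1 : ℝ) < 4)] with t ht
    have h1 : |p t / r t| ≤ 2 := abs_le_of_sq_le_sq (by nlinarith [sq_nonneg (q t / r t)]) (by norm_num)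
    have h2 : |q t / r t| ≤ 2 := abs_le_of_sq_le_sq (by nlinarith [sq_nonneg (p t / r t)]) (by norm_num)
    exact ⟨abs_le.1 h1, abs_le.1 h2⟩
  have hunit : e.1 ^ 2 + e.2 ^ 2 = 1 := by
    have h1 : MapClusterPt (e.1 ^ 2 + e.2 ^ 2) (𝓝[<] τ)
        (fun t => (p t / r t) ^ 2 + (q t / r t) ^ 2) :=
      he.continuousAt_comp (f := fun u : ℝ × ℝ => u.1 ^ 2 + u.2 ^ 2) (by fun_prop)
    by_contra hne
    obtain ⟨U, V, hU, hV, hxU, hxV, hUV⟩ := t2_separation hne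
    have hf := mapClusterPt_iff_frequently.1 h1 U (hU.mem_nhds hxU)
    obtain ⟨t, ht1, ht2⟩ := (hf.and_eventually (hnorm (hV.mem_nhds hxV))).exists
    exact hUV.le_bot ⟨ht1, ht2⟩
  obtain ⟨θ, hθ1, hθ2⟩ := exists_angle_of_sq_add_sq_eq_one hunit
  -- The product of the velocity at `s` with the normalized velocity at `t` is at least `c / r t`,
  -- hence nonnegative; this closed condition passes to the cluster point.
  have hw' : ∀ s ∈ Ioo 0 τ, 0 ≤ p s * θ.cos + q s * θ.sin - r s := fun s hs => by
    have hcl : IsClosed {u : ℝ × ℝ | 0 ≤ p s * u.1 + q s * u.2 - r s} :=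
      isClosed_le (by fun_prop) (by fun_prop)
    have : e ∈ {u : ℝ × ℝ | 0 ≤ p s * u.1 + q s * u.2 - r s} := by
      refine hcl.mem_of_mapClusterPt he ?_
      filter_upwards [Ico_mem_nhdsLT hs.2, hIoo, hrpos] with t hst ht ht1
      have h1 := h.le_form_velocity hs ht hst.1
      have h0 : 0 < r t := by linarith
      have : p s * (p t / r t) + q s * (q t / r t) - r s
          = (p t * p s + q t * q s - r t * r s) / r t := by field_simp
      rw [this]
      exact div_nonneg (hc.le.trans h1) h0.le
    simpa [hθ1, hθ2] using this
  have hθ : θ.cos ^ 2 + θ.sin ^ 2 = 1 := θ.cos_sq_add_sin_sq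
  -- Expanding the square and using `hw'` at time `t` bounds the distance to the cluster point by
  -- the excess of the squared norm over `1`, so the whole family converges.
  have hdir : Tendsto (fun t => (p t / r t - θ.cos) ^ 2 + (q t / r t - θ.sin) ^ 2) (𝓝[<] τ)
      (𝓝 0) := by
    have h1 := hnorm.sub_const 1
    rw [sub_self] at h1
    refine squeeze_zero' (Eventually.of_forall fun t => by positivity) ?_ h1
    filter_upwards [hIoo, hrpos] with t ht ht1
    have h0 : 0 < r t := by linarith
    have h2 : 1 ≤ p t / r t * θ.cos + q t / r t * θ.sin := by
      rw [div_mul_eq_mul_div, div_mul_eq_mul_div, ← add_div, le_div_iff₀ h0]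
      linarith [hw' t ht]
    calc _ = (p t / r t) ^ 2 + (q t / r t) ^ 2 + (θ.cos ^ 2 + θ.sin ^ 2)
          - 2 * (p t / r t * θ.cos + q t / r t * θ.sin) := by ring
      _ ≤ _ := by linarith
  have hsqrt : ∀ {g : ℝ → ℝ} {l : ℝ}, (∀ t, (g t - l) ^ 2 ≤
      (p t / r t - θ.cos) ^ 2 + (q t / r t - θ.sin) ^ 2) → Tendsto g (𝓝[<] τ) (𝓝 l) := by
    intro g l hg
    have h1 := (Real.continuous_sqrt.tendsto 0).comp hdir
    rw [Real.sqrt_zero] at h1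
    rw [tendsto_iff_dist_tendsto_zero]
    refine squeeze_zero (fun t => dist_nonneg) (fun t => ?_) h1
    exact Real.abs_le_sqrt (hg t)
  refine ⟨θ, hw', hsqrt fun t => ?_, hsqrt fun t => ?_⟩
  · exact le_add_of_nonneg_right (sq_nonneg _)
  · exact le_add_of_nonneg_left (sq_nonneg _)

/-- The asymptotic behaviour of a curve which leaves every compact set. -/
theorem exists_angle_asymptotics (h : IsFutureAccelerated τ c x y z p q r p' q' r') (hτ : 0 < τ) (hc : 0 < c)
    (hproper : Tendsto (fun t => x t ^ 2 + y t ^ 2 + z t ^ 2) (𝓝[<] τ) atTop) :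
    ∃ (θ : Real.Angle) (w v : ℝ), Tendsto r (𝓝[<] τ) atTop ∧ Tendsto z (𝓝[<] τ) atTop ∧
      Tendsto (fun t => p t / r t) (𝓝[<] τ) (𝓝 θ.cos) ∧
      Tendsto (fun t => q t / r t) (𝓝[<] τ) (𝓝 θ.sin) ∧
      Tendsto (fun t => x t * θ.cos + y t * θ.sin - z t) (𝓝[<] τ) (𝓝 w) ∧
      Tendsto (fun t => y t * θ.cos - x t * θ.sin) (𝓝[<] τ) (𝓝 v) := by
  have hrtop := h.tendsto_atTop hτ hproper
  obtain ⟨θ, hw', hdir⟩ := h.exists_angle hτ hc hrtop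
  have hθ : θ.cos ^ 2 + θ.sin ^ 2 = 1 := θ.cos_sq_add_sin_sq
  have hwanti := h.antitoneOn (a := θ.cos) (b := θ.sin) (d := 1) (by norm_num) (by rw [hθ]; norm_num)
  -- After `s` the vertical velocity exceeds `1`: `z` increases and signs of squared quantities are
  -- under control.
  obtain ⟨s, hs, hs1⟩ := (Filter.Eventually.and (Ioo_mem_nhdsLT hτ) (hrtop.eventually_gt_atTop 1)).exists
  have hsub : Ico s τ ⊆ Ioo 0 τ := fun t ht => ⟨hs.1.trans_le ht.1, ht.2⟩
  obtain ⟨w, hw⟩ := exists_tendsto_nhdsLT_of_abs_deriv_le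
    (g := fun t => x t * θ.cos + y t * θ.sin - z t) hs.2
    (fun t ht => (((h.hx t (hsub ht)).mul_const θ.cos).add ((h.hy t (hsub ht)).mul_const θ.sin)).sub
      (h.hz t (hsub ht))) (C := p s * θ.cos + q s * θ.sin - r s) (fun t ht => by
        have := hwanti hs (hsub ht) ht.1
        simp only at this
        rw [abs_of_nonneg (hw' t (hsub ht))]
        linarith)
  obtain ⟨v, hv⟩ := exists_tendsto_nhdsLT_of_abs_deriv_le
    (g := fun t => y t * θ.cos - x t * θ.sin) hs.2
    (fun t ht => ((h.hy t (hsub ht)).mul_const θ.cos).sub ((h.hx t (hsub ht)).mul_const θ.sin))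
    -- The squared transverse velocity is `c + r ^ 2 - (p cos θ + q sin θ) ^ 2`, and `hw'` gives `p
    -- cos θ + q sin θ ≥ r > 0`.
    (C := Real.sqrt c) (fun t ht => by
        refine Real.abs_le_sqrt ?_
        have h1 := hw' t (hsub ht)
        have h2 := h.monotoneOn hs (hsub ht) ht.1
        have h3 := h.speed t (hsub ht)
        have h4 : (q t * θ.cos - p t * θ.sin) ^ 2 + (p t * θ.cos + q t * θ.sin) ^ 2
            = p t ^ 2 + q t ^ 2 := by
          linear_combination (p t ^ 2 + q t ^ 2) * hθ
        nlinarith)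
  refine ⟨θ, w, v, hrtop, ?_, hdir.1, hdir.2, hw, hv⟩
  · have hzmono : ∀ t ∈ Ico s τ, z s ≤ z t := by
      have : MonotoneOn z (Ico s τ) := by
        refine monotoneOn_of_deriv_nonneg (convex_Ico s τ)
          (fun t ht => (h.hz t (hsub ht)).continuousAt.continuousWithinAt) ?_ ?_
        · rw [interior_Ico]
          exact fun t ht => (h.hz t (hsub ⟨ht.1.le, ht.2⟩)).differentiableAt.differentiableWithinAt
        · rw [interior_Ico]
          intro t ht
          rw [(h.hz t (hsub ⟨ht.1.le, ht.2⟩)).deriv]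
          linarith [h.monotoneOn hs (hsub ⟨ht.1.le, ht.2⟩) ht.1.le]
      exact fun t ht => this ⟨le_rfl, hs.2⟩ ht ht.1
    -- With the other two adapted coordinates bounded by `K`, a bound `N` on `|z|` would bound the
    -- whole position, against properness.
    refine Filter.tendsto_atTop.2 fun M => ?_
    obtain ⟨K, hK⟩ : ∃ K, ∀ᶠ t in 𝓝[<] τ, |x t * θ.cos + y t * θ.sin - z t| ≤ K ∧
        |y t * θ.cos - x t * θ.sin| ≤ K := by
      refine ⟨max (|w| + 1) (|v| + 1), ?_⟩
      filter_upwards [hw.abs.eventually_le_const (lt_add_one |w|),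
        hv.abs.eventually_le_const (lt_add_one |v|)] with t h1 h2
      exact ⟨h1.trans (le_max_left _ _), h2.trans (le_max_right _ _)⟩
    set N := max |M| |z s| with hN
    have hN0 : 0 ≤ N := (abs_nonneg M).trans (le_max_left _ _)
    filter_upwards [hK, Ico_mem_nhdsLT hs.2,
      hproper.eventually_gt_atTop ((N + K) ^ 2 + K ^ 2 + N ^ 2)] with t ht hst hbig
    have hz1 := hzmono t hst
    have hzN : -N ≤ z t := by
      linarith [neg_abs_le (z s), le_max_right |M| |z s|]
    by_contra! hlt
    have hzN' : z t ≤ N := by linarith [le_abs_self M, le_max_left |M| |z s|]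
    have h4 : (y t * θ.cos - x t * θ.sin) ^ 2 + (x t * θ.cos + y t * θ.sin) ^ 2
        = x t ^ 2 + y t ^ 2 := by
      linear_combination (x t ^ 2 + y t ^ 2) * hθ
    have h5 : (y t * θ.cos - x t * θ.sin) ^ 2 ≤ K ^ 2 :=
      sq_le_sq' (abs_le.1 ht.2).1 (abs_le.1 ht.2).2
    have h6 : (x t * θ.cos + y t * θ.sin) ^ 2 ≤ (N + K) ^ 2 :=
      sq_le_sq' (by linarith [(abs_le.1 ht.1).1]) (by linarith [(abs_le.1 ht.1).2])
    have h7 : z t ^ 2 ≤ N ^ 2 := sq_le_sq' hzN hzN'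
    linarith

end IsFutureAccelerated

/-! ### Convex spacelike graphs and their tangent planes. -/

theorem form_self_eq (v : Space) : form v v = ‖v.1‖ ^ 2 - v.2 ^ 2 := by
  rw [EuclideanSpace.norm_sq_eq, Fin.sum_univ_two, form]
  simp only [Real.norm_eq_abs, sq_abs]
  ring

/-- A convex entire spacelike surface is the graph of a convex differentiable function on the
plane whose differential has norm less than one. -/
theorem IsConvexEntireSpacelike.exists_graph {S : Set Space} (hS : IsConvexEntireSpacelike S) :
    ∃ f : Plane → ℝ, ConvexOn ℝ univ f ∧ (∀ p, p ∈ S ↔ p.2 = f p.1) ∧ Differentiable ℝ f ∧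
      ∀ a, ‖fderiv ℝ f a‖ < 1 := by
  obtain ⟨D, f, hf, hSf⟩ := hS.isConvexSurface
  have hD : D = univ := by
    refine eq_univ_of_forall fun a => ?_
    -- Vertical lines are timelike, so the surface meets each of them.
    obtain ⟨q, ⟨hq, r, hqr⟩, -⟩ := hS.isEntire.2 (a, 0) (0, 1) (by simp [IsTimelike, form])
    rw [hSf] at hq
    have : q.1 = a := by rw [hqr]; simp
    exact this ▸ hq.1
  subst hD
  have hmem : ∀ p, p ∈ S ↔ p.2 = f p.1 := fun p => by rw [hSf]; simp [graphOn]
  have hcont : Continuous f := hf.locallyLipschitz.continuous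
  have hloc : ∀ a, DifferentiableAt ℝ f a ∧ ‖fderiv ℝ f a‖ < 1 := fun a => by
    obtain ⟨W, U, g, hW, haW, hU, hg, hg1, hSW⟩ := hS.isSpacelike (a, f a) ((hmem _).2 rfl)
    have key : ∀ b, (b, f b) ∈ W → b ∈ U ∧ f b = g b := fun b hb => by
      have h1 : (b, f b) ∈ S ∩ W := ⟨(hmem _).2 rfl, hb⟩
      rw [hSW] at h1
      exact h1.1
    -- Continuity of the convex function `f` keeps nearby points of its graph inside `W`, where the
    -- surface is also the graph of `g`.
    have hev : f =ᶠ[𝓝 a] g := by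
      have : ∀ᶠ b in 𝓝 a, (b, f b) ∈ W :=
        (by fun_prop : Continuous fun b => (b, f b)).continuousAt (hW.mem_nhds haW)
      filter_upwards [this] with b hb using (key b hb).2
    have haU := (key a haW).1
    have hd : DifferentiableAt ℝ g a :=
      (hg.contDiffAt (hU.mem_nhds haU)).differentiableAt (by norm_num)
    exact ⟨hd.congr_of_eventuallyEq hev, by rw [hev.fderiv_eq]; exact hg1 a haU⟩
  exact ⟨f, hf, hmem, fun a => (hloc a).1, fun a => (hloc a).2⟩

/-- A differentiable convex function lies above its tangent planes. -/
theorem _root_.ConvexOn.add_fderiv_le {E : Type*} [NormedAddCommGroup E] [NormedSpace ℝ E]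
    {f : E → ℝ} (hf : ConvexOn ℝ univ f) {a : E} (hd : DifferentiableAt ℝ f a) (b : E) :
    f a + fderiv ℝ f a (b - a) ≤ f b := by
  have hconv : ConvexOn ℝ univ (f ∘ AffineMap.lineMap (k := ℝ) a b) := hf.comp_affineMap _
  have hderiv : HasDerivAt (f ∘ AffineMap.lineMap (k := ℝ) a b) (fderiv ℝ f a (b - a)) 0 := by
    refine HasFDerivAt.comp_hasDerivAt_of_eq (0 : ℝ) hd.hasFDerivAt AffineMap.hasDerivAt_lineMap ?_
    simp
  have := hconv.le_slope_of_hasDerivAt (mem_univ _) (mem_univ _) one_pos hderiv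
  simp only [slope_def_field, Function.comp_apply, AffineMap.lineMap_apply_one,
    AffineMap.lineMap_apply_zero, sub_zero, div_one] at this
  linarith

section Graph

variable {S : Set Space} {f : Plane → ℝ}

/-- Together with `IsTangent.snd_eq`, this identifies the tangent plane with the graph of the
differential. This half supplies test vectors for the normal acceleration; the other half makes the
velocity spacelike. -/
theorem isTangent_of_graph (hmem : ∀ p, p ∈ S ↔ p.2 = f p.1) (hd : Differentiable ℝ f)
    {p : Space} (hp : p ∈ S) (v : Plane) : IsTangent S p (v, fderiv ℝ f p.1 v) := by
  have hline : HasDerivAt (fun s : ℝ => p.1 + s • v) v 0 := by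
    simpa using ((hasDerivAt_id (0 : ℝ)).smul_const v).const_add p.1
  refine ⟨fun s => (p.1 + s • v, f (p.1 + s • v)), ?_, Eventually.of_forall fun s => (hmem _).2 rfl,
    hline.prodMk ?_⟩
  · ext1
    · simp
    · simpa using ((hmem p).1 hp).symm
  · exact HasFDerivAt.comp_hasDerivAt_of_eq (0 : ℝ) (hd p.1).hasFDerivAt hline (by simp)

theorem IsTangent.snd_eq (hmem : ∀ p, p ∈ S ↔ p.2 = f p.1) (hd : Differentiable ℝ f)
    {p v : Space} (hv : IsTangent S p v) : v.2 = fderiv ℝ f p.1 v.1 := by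
  obtain ⟨c, hc0, hcS, hc⟩ := hv
  have h1 : HasDerivAt (fun s => (c s).1) v.1 0 :=
    (ContinuousLinearMap.fst ℝ Plane ℝ).hasFDerivAt.comp_hasDerivAt 0 hc
  have h2 : HasDerivAt (fun s => (c s).2) v.2 0 :=
    (ContinuousLinearMap.snd ℝ Plane ℝ).hasFDerivAt.comp_hasDerivAt 0 hc
  have h3 : HasDerivAt (fun s => f (c s).1) (fderiv ℝ f p.1 v.1) 0 :=
    HasFDerivAt.comp_hasDerivAt_of_eq (0 : ℝ) (hd p.1).hasFDerivAt h1 (by rw [hc0])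
  refine h2.unique (h3.congr_of_eventuallyEq ?_)
  filter_upwards [hcS] with s hs using (hmem _).1 hs

/-- A tangent vector to a spacelike graph is spacelike or zero. -/
theorem form_self_nonneg_of_snd_eq {v : Space} {L : Plane →L[ℝ] ℝ} (hL : ‖L‖ < 1)
    (hv : v.2 = L v.1) : 0 ≤ form v v ∧ (form v v = 0 → v = 0) := by
  have h1 : |v.2| ≤ ‖L‖ * ‖v.1‖ := by rw [hv]; exact L.le_opNorm _
  have h2 : v.2 ^ 2 ≤ (‖L‖ * ‖v.1‖) ^ 2 := by
    rw [← sq_abs]; gcongr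
  have h4 : ‖L‖ ^ 2 < 1 := by
    rw [sq_lt_one_iff_abs_lt_one, abs_of_nonneg (norm_nonneg L)]; exact hL
  rw [form_self_eq]
  refine ⟨by nlinarith [sq_nonneg ‖v.1‖], fun h => ?_⟩
  have h5 : ‖v.1‖ ^ 2 ≤ 0 := by
    by_contra! hpos
    nlinarith
  have h6 : v.1 = 0 := norm_eq_zero.1 (pow_eq_zero_iff two_ne_zero |>.1 (le_antisymm h5 (sq_nonneg _)))
  exact Prod.ext h6 (by rw [hv, h6]; simp)

/-- A vector orthogonal to a spacelike plane which lies on or above the plane is future causal. -/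
theorem future_causal_of_orthogonal {a : Space} {L : Plane →L[ℝ] ℝ} (hL : ‖L‖ < 1)
    (ha : ∀ v, form a (v, L v) = 0) (hab : L a.1 ≤ a.2) :
    0 ≤ a.2 ∧ a.1 0 ^ 2 + a.1 1 ^ 2 ≤ a.2 ^ 2 := by
  have h0 := ha a.1
  have hn : ‖a.1‖ ^ 2 = a.1 0 ^ 2 + a.1 1 ^ 2 := by
    rw [EuclideanSpace.norm_sq_eq, Fin.sum_univ_two]
    simp only [Real.norm_eq_abs, sq_abs]
  have h1 : ‖a.1‖ ^ 2 = a.2 * L a.1 := by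
    simp only [form] at h0
    rw [hn]; linarith
  have h2 : |L a.1| ≤ ‖L‖ * ‖a.1‖ := L.le_opNorm _
  have h3 : ‖a.1‖ ^ 2 ≤ |a.2| * (‖L‖ * ‖a.1‖) := by
    rw [h1]
    calc _ ≤ |a.2 * L a.1| := le_abs_self _
      _ = |a.2| * |L a.1| := abs_mul _ _
      _ ≤ _ := by gcongr
  have h4 : ‖a.1‖ ≤ |a.2| * ‖L‖ := by
    rcases (norm_nonneg a.1).eq_or_lt with h | h
    · rw [← h]; positivity
    · exact le_of_mul_le_mul_right (by nlinarith) h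
  have h5 : ‖a.1‖ ^ 2 ≤ a.2 ^ 2 * ‖L‖ ^ 2 := by
    rw [← sq_abs a.2, ← mul_pow]; gcongr
  have h6 : ‖L‖ ^ 2 < 1 := by
    rw [sq_lt_one_iff_abs_lt_one, abs_of_nonneg (norm_nonneg L)]; exact hL
  refine ⟨?_, by rw [← hn]; nlinarith [sq_nonneg a.2]⟩
  -- If `a.2 < 0` then `L a.1 ≤ a.2 < 0`, so `h1` gives `‖a.1‖ ^ 2 ≥ a.2 ^ 2`, against `h5` and
  -- `h6`.
  by_contra! hneg
  nlinarith [mul_pos_of_neg_of_neg hneg hneg]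

end Graph

/-! ### The interval `[0, T)`, its end, and properness. -/

section Ray

variable {T : EReal}

/-- The open interval `(0, T)`. -/
def openRay (T : EReal) : Set ℝ := {t | 0 < t ∧ (t : EReal) < T}

theorem isOpen_openRay : IsOpen (openRay T) :=
  isOpen_Ioi.inter (isOpen_Iio.preimage continuous_coe_real_ereal)

theorem convex_openRay : Convex ℝ (openRay T) := by
  refine OrdConnected.convex ⟨fun a ha b hb c hc => ⟨ha.1.trans_le hc.1, ?_⟩⟩
  exact lt_of_le_of_lt (EReal.coe_le_coe_iff.2 hc.2) hb.2

theorem ray_mem_nhds {t : ℝ} (ht : t ∈ openRay T) : ray T ∈ 𝓝 t :=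
  mem_of_superset (isOpen_openRay.mem_nhds ht) fun _ hs => ⟨hs.1.le, hs.2⟩

theorem eventually_lt_toEnd {t : ℝ} (ht : (t : EReal) < T) : ∀ᶠ s in toEnd T, t < s := by
  have : ∀ᶠ x : EReal in 𝓝[<] T, (t : EReal) < x := mem_nhdsWithin_of_mem_nhds (Ioi_mem_nhds ht)
  exact (this.comap _).mono fun s hs => EReal.coe_lt_coe_iff.1 hs

theorem eventually_coe_lt_toEnd : ∀ᶠ s : ℝ in toEnd T, (s : EReal) < T :=
  (eventually_mem_nhdsWithin (a := T) (s := Iio T)).comap _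

theorem toEnd_neBot (hT : 0 < T) : (toEnd T).NeBot := by
  refine comap_neBot fun s hs => ?_
  obtain ⟨l, hl, hs⟩ := (mem_nhdsLT_iff_exists_Ioo_subset' hT).1 hs
  obtain ⟨x, hlx, hxT⟩ := EReal.exists_between_coe_real hl
  exact ⟨x, hs ⟨hlx, hxT⟩⟩

theorem toEnd_coe (τ : ℝ) : toEnd (τ : EReal) = 𝓝[<] τ := by
  rw [toEnd, nhdsWithin, nhdsWithin, comap_inf, comap_principal,
    ← EReal.isOpenEmbedding_coe.isEmbedding.isInducing.nhds_eq_comap]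
  congr 2
  ext s
  simp

theorem openRay_coe (τ : ℝ) : openRay (τ : EReal) = Ioo 0 τ := by
  ext s
  simp [openRay]

theorem uniqueDiffOn_ray (hT : 0 < T) : UniqueDiffOn ℝ (ray T) := by
  have hconv : Convex ℝ (ray T) := by
    refine OrdConnected.convex ⟨fun a ha b hb c hc => ⟨ha.1.trans hc.1, ?_⟩⟩
    exact lt_of_le_of_lt (EReal.coe_le_coe_iff.2 hc.2) hb.2
  refine uniqueDiffOn_convex hconv ?_
  obtain ⟨x, hx0, hxT⟩ := EReal.exists_between_coe_real hT
  exact ⟨x, mem_interior_iff_mem_nhds.2 (ray_mem_nhds ⟨by exact_mod_cast hx0, hxT⟩)⟩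

end Ray

theorem _root_.HasDerivAt.space_coord {c : ℝ → Space} {v : Space} {t : ℝ} (h : HasDerivAt c v t)
    (i : Fin 2) : HasDerivAt (fun s => (c s).1 i) (v.1 i) t :=
  ((EuclideanSpace.proj i : Plane →L[ℝ] ℝ).comp
    (ContinuousLinearMap.fst ℝ Plane ℝ)).hasFDerivAt.comp_hasDerivAt t h

theorem _root_.HasDerivAt.space_snd {c : ℝ → Space} {v : Space} {t : ℝ} (h : HasDerivAt c v t) :
    HasDerivAt (fun s => (c s).2) v.2 t :=
  (ContinuousLinearMap.snd ℝ Plane ℝ).hasFDerivAt.comp_hasDerivAt t h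

theorem norm_sq_le (v : Space) : ‖v‖ ^ 2 ≤ v.1 0 ^ 2 + v.1 1 ^ 2 + v.2 ^ 2 := by
  have hn : ‖v.1‖ ^ 2 = v.1 0 ^ 2 + v.1 1 ^ 2 := by
    rw [EuclideanSpace.norm_sq_eq, Fin.sum_univ_two]
    simp only [Real.norm_eq_abs, sq_abs]
  rw [← hn, Prod.norm_def]
  rcases max_cases ‖v.1‖ ‖v.2‖ with h | h <;> rw [h.1]
  · nlinarith [sq_nonneg v.2]
  · rw [Real.norm_eq_abs, sq_abs]; nlinarith [sq_nonneg ‖v.1‖]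

/-- A curve in a closed set which is proper as a map from `[0, T)` leaves every bounded set. -/
theorem tendsto_norm_of_isProperMap {S : Set Space} (hS : IsClosed S) {T : EReal} (hT : 0 < T)
    {γ : ℝ → Space} (hγ : MapsTo γ (ray T) S)
    (hproper : IsProperMap (hγ.restrict γ (ray T) S)) :
    Tendsto (fun t => ‖γ t‖) (toEnd T) atTop := by
  refine tendsto_atTop.2 fun R => ?_
  have hK : IsCompact ((↑) ⁻¹' Metric.closedBall (0 : Space) R : Set S) :=
    hS.isClosedEmbedding_subtypeVal.isCompact_preimage (isCompact_closedBall _ _)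
  have hK' := (hproper.isCompact_preimage hK).image continuous_subtype_val
  -- The times spent in the ball form a compact subset of `[0, T)`, whose last element, if there is
  -- one, lies before `T`.
  obtain ⟨t, ht, hle⟩ : ∃ t : ℝ, (t : EReal) < T ∧ ∀ s ∈ ray T, ‖γ s‖ ≤ R → s ≤ t := by
    have hsub : ∀ s ∈ ray T, ‖γ s‖ ≤ R → s ∈ ((↑) : ray T → ℝ) ''
        (hγ.restrict γ (ray T) S ⁻¹' ((↑) ⁻¹' Metric.closedBall (0 : Space) R)) :=
      fun s hs hR => ⟨⟨s, hs⟩, by simpa using hR, rfl⟩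
    rcases eq_empty_or_nonempty (((↑) : ray T → ℝ) ''
      (hγ.restrict γ (ray T) S ⁻¹' ((↑) ⁻¹' Metric.closedBall (0 : Space) R))) with h | h
    · refine ⟨0, by exact_mod_cast hT, fun s hs hR => ?_⟩
      have := hsub s hs hR
      rw [h] at this
      exact this.elim
    · obtain ⟨t, ⟨t', -, rfl⟩, hmax⟩ := hK'.exists_isGreatest h
      exact ⟨t', t'.2.2, fun s hs hR => hmax (hsub s hs hR)⟩
  filter_upwards [eventually_lt_toEnd ht, eventually_lt_toEnd (t := 0) (by exact_mod_cast hT),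
    eventually_coe_lt_toEnd] with s hs hs0 hsT
  by_contra! hR
  exact (hle s ⟨hs0.le, hsT⟩ hR.le).not_gt hs

/-! ### Geodesics: constant speed and causal acceleration. -/

namespace IsGeodesic

variable {S : Set Space} {T : EReal} {γ : ℝ → Space} {f : Plane → ℝ}

theorem hasDerivAt (hγ : IsGeodesic S T γ) {t : ℝ} (ht : t ∈ openRay T) :
    HasDerivAt γ (velocity γ T t) t :=
  ((hγ.contDiffOn.differentiableOn (by norm_num) t
    ⟨ht.1.le, ht.2⟩).hasDerivWithinAt).hasDerivAt (ray_mem_nhds ht)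

theorem hasDerivAt_velocity (hγ : IsGeodesic S T γ) (hT : 0 < T) {t : ℝ} (ht : t ∈ openRay T) :
    HasDerivAt (velocity γ T) (acceleration γ T t) t := by
  have h : ContDiffOn ℝ 1 (velocity γ T) (ray T) :=
    hγ.contDiffOn.derivWithin (uniqueDiffOn_ray hT) (by norm_num)
  exact ((h.differentiableOn (by norm_num) t
    ⟨ht.1.le, ht.2⟩).hasDerivWithinAt).hasDerivAt (ray_mem_nhds ht)

theorem isTangent_velocity (hγ : IsGeodesic S T γ) {t : ℝ} (ht : t ∈ openRay T) :
    IsTangent S (γ t) (velocity γ T t) := by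
  have hlin : HasDerivAt (fun s : ℝ => t + s) 1 0 := (hasDerivAt_id (0 : ℝ)).const_add t
  refine ⟨fun s => γ (t + s), by simp, ?_, ?_⟩
  · have : Tendsto (fun s : ℝ => t + s) (𝓝 0) (𝓝 t) := by
      simpa using hlin.continuousAt.tendsto
    filter_upwards [this (ray_mem_nhds ht)] with s hs using hγ.mapsTo hs
  · exact (HasDerivAt.scomp_of_eq (0 : ℝ) (hγ.hasDerivAt ht) hlin (by simp)).congr_deriv
      (one_smul ℝ _)

/-- A geodesic has constant speed. -/
theorem exists_form_velocity_eq (hγ : IsGeodesic S T γ) (hT : 0 < T) :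
    ∃ c, ∀ t ∈ openRay T, form (velocity γ T t) (velocity γ T t) = c := by
  have hd : ∀ t ∈ openRay T,
      HasDerivAt (fun s => form (velocity γ T s) (velocity γ T s)) 0 t := fun t ht => by
    have h := hγ.hasDerivAt_velocity hT ht
    have h0 := h.space_coord 0
    have h1 := h.space_coord 1
    have h2 := h.space_snd
    refine (((h0.mul h0).add (h1.mul h1)).sub (h2.mul h2)).congr_deriv ?_
    have := hγ.acceleration_normal t ⟨ht.1.le, ht.2⟩ _ (hγ.isTangent_velocity ht)
    simp only [form] at this
    linarith
  exact isOpen_openRay.exists_is_const_of_deriv_eq_zero convex_openRay.isPreconnected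
    (fun t ht => (hd t ht).differentiableAt.differentiableWithinAt) (fun t ht => (hd t ht).deriv)

/-- The acceleration of a geodesic of a convex spacelike graph is future causal. -/
theorem acceleration_causal (hγ : IsGeodesic S T γ) (hT : 0 < T) (hf : ConvexOn ℝ univ f)
    (hmem : ∀ p, p ∈ S ↔ p.2 = f p.1) (hd : Differentiable ℝ f) (hf1 : ∀ a, ‖fderiv ℝ f a‖ < 1)
    {t : ℝ} (ht : t ∈ openRay T) : 0 ≤ (acceleration γ T t).2 ∧
      (acceleration γ T t).1 0 ^ 2 + (acceleration γ T t).1 1 ^ 2 ≤ (acceleration γ T t).2 ^ 2 := by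
  have htr : t ∈ ray T := ⟨ht.1.le, ht.2⟩
  refine future_causal_of_orthogonal (hf1 (γ t).1) (fun v =>
    hγ.acceleration_normal t htr _ (isTangent_of_graph hmem hd (hγ.mapsTo htr) v)) ?_
  set L := fderiv ℝ f (γ t).1 with hL
  have hlin : ∀ {c : ℝ → Space} {v : Space} {s : ℝ}, HasDerivAt c v s →
      HasDerivAt (fun s => (c s).2 - L (c s).1) (v.2 - L v.1) s := fun h =>
    h.space_snd.sub
      ((L.comp (ContinuousLinearMap.fst ℝ Plane ℝ)).hasFDerivAt.comp_hasDerivAt _ h)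
  -- By convexity the curve stays above the tangent plane at `γ t`, so its height over that plane is
  -- minimal at time `t`.
  refine sub_nonneg.1 (second_deriv_nonneg_of_isLocalMin
    (h := fun s => (γ s).2 - L (γ s).1) (t := t) ?_ ?_ (hlin (hγ.hasDerivAt_velocity hT ht)))
  · filter_upwards [ray_mem_nhds ht] with s hs
    have h1 := hf.add_fderiv_le (hd (γ t).1) (γ s).1
    rw [map_sub, ← (hmem _).1 (hγ.mapsTo htr), ← (hmem _).1 (hγ.mapsTo hs)] at h1
    linarith
  · filter_upwards [isOpen_openRay.mem_nhds ht] with s hs using hlin (hγ.hasDerivAt hs)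

end IsGeodesic

/-- A curve of constant positive speed and finite length is defined on a bounded interval. -/
theorem ne_top_of_length_lt_top {T : EReal} {γ : ℝ → Space} {c : ℝ} (hc : 0 < c)
    (hspeed : ∀ t ∈ openRay T, form (velocity γ T t) (velocity γ T t) = c)
    (hlength : length T γ < ⊤) : T ≠ ⊤ := by
  rintro rfl
  have hIoi : openRay ⊤ = Ioi 0 := by ext t; simp [openRay]
  have h1 : ∫⁻ _ in Ioi (0 : ℝ), ENNReal.ofReal (Real.sqrt c) ≤ length ⊤ γ := by
    calc _ = ∫⁻ t in Ioi (0 : ℝ),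
          ENNReal.ofReal (Real.sqrt (form (velocity γ ⊤ t) (velocity γ ⊤ t))) := by
          refine setLIntegral_congr_fun measurableSet_Ioi fun t ht => ?_
          rw [hspeed t (hIoi ▸ ht)]
      _ ≤ _ := lintegral_mono_set (t := ray ⊤) fun t ht => ⟨le_of_lt ht, EReal.coe_lt_top t⟩
  rw [setLIntegral_const, Real.volume_Ioi, ENNReal.mul_top (by simpa using hc)] at h1
  exact (h1.trans_lt hlength).ne rfl

/-! ### Asymptotic null lines. -/

section NullLine

theorem nullLine_direction (x : Space) (θ : Real.Angle) :
    (nullLine x θ).direction = Submodule.span ℝ {nullVec θ} :=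
  AffineSubspace.direction_mk' _ _

theorem isAsymptoticTo_nullLine_iff {γ : ℝ → Space} {l : Filter ℝ} {x : Space} {θ : Real.Angle} :
    IsAsymptoticTo γ l (nullLine x θ) ↔ Tendsto (fun t => (Submodule.span ℝ {nullVec θ}).mkQ (γ t)) l
      (𝓝 ((Submodule.span ℝ {nullVec θ}).mkQ x)) := by
  rw [IsAsymptoticTo, nullLine_direction]
  constructor
  · rintro ⟨y, hy, h⟩
    have : (Submodule.span ℝ {nullVec θ}).mkQ y = (Submodule.span ℝ {nullVec θ}).mkQ x :=
      (Submodule.Quotient.eq _).2 (AffineSubspace.mem_mk'.1 hy)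
    rwa [this] at h
  · exact fun h => ⟨x, AffineSubspace.self_mem_mk' _ _, h⟩

theorem nullLine_eq_of_mkQ_eq {x y : Space} {θ : Real.Angle}
    (h : (Submodule.span ℝ {nullVec θ}).mkQ x = (Submodule.span ℝ {nullVec θ}).mkQ y) :
    nullLine x θ = nullLine y θ := by
  have hxy : x ∈ nullLine y θ := AffineSubspace.mem_mk'.2 ((Submodule.Quotient.eq _).1 h)
  have := AffineSubspace.mk'_eq hxy
  rwa [nullLine_direction] at this

/-- A curve is asymptotic to exactly one null line in the direction `θ` if it converges modulo
`nullVec θ`. -/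
theorem existsUnique_isAsymptoticTo {γ : ℝ → Space} {l : Filter ℝ} [l.NeBot] {θ : Real.Angle}
    {ρ : ℝ → ℝ} {x : Space} (h : Tendsto (fun t => γ t - ρ t • nullVec θ) l (𝓝 x)) :
    ∃! L : AffineSubspace ℝ Space, (∃ x : Space, L = nullLine x θ) ∧ IsAsymptoticTo γ l L := by
  set N := Submodule.span ℝ {nullVec θ} with hN
  -- Closedness makes the quotient Hausdorff, so that limits in it are unique.
  have hcl : IsClosed (N : Set Space) := N.closed_of_finiteDimensional
  have hlim : Tendsto (fun t => N.mkQ (γ t)) l (𝓝 (N.mkQ x)) := by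
    refine ((N.mkQL.continuous.tendsto x).comp h).congr fun t => ?_
    refine (Submodule.Quotient.eq _).2 ?_
    rw [sub_sub_cancel_left]
    exact N.neg_mem (N.smul_mem _ (Submodule.mem_span_singleton_self _))
  refine ⟨nullLine x θ, ⟨⟨x, rfl⟩, isAsymptoticTo_nullLine_iff.2 hlim⟩, ?_⟩
  rintro _ ⟨⟨y, rfl⟩, hy⟩
  exact nullLine_eq_of_mkQ_eq (tendsto_nhds_unique (isAsymptoticTo_nullLine_iff.1 hy) hlim)

end NullLine

/-! ### Projective convergence. -/

section Projective

variable {v : ℝ → Space} {l : Filter ℝ} {θ θ' : Real.Angle}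

theorem convergesProjectively_nullVec (hpos : ∀ᶠ t in l, 0 < (v t).2)
    (h0 : Tendsto (fun t => (v t).1 0 / (v t).2) l (𝓝 θ.cos))
    (h1 : Tendsto (fun t => (v t).1 1 / (v t).2) l (𝓝 θ.sin)) :
    ConvergesProjectively v l (nullVec θ) := by
  intro U hU _ hsmul hθ
  have hlim : Tendsto (fun t => ((!₂[(v t).1 0 / (v t).2, (v t).1 1 / (v t).2], 1) : Space)) l
      (𝓝 (nullVec θ)) := by
    have hc : Continuous fun a : ℝ × ℝ => ((!₂[a.1, a.2], 1) : Space) := by fun_prop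
    exact (hc.tendsto (θ.cos, θ.sin)).comp (h0.prodMk_nhds h1)
  filter_upwards [hlim (hU.mem_nhds hθ), hpos] with t ht ht0
  have := hsmul (v t).2 ht0.ne' _ ht
  convert this using 1
  refine Prod.ext ?_ (by simp)
  ext i
  fin_cases i <;> simp <;> field_simp

/-- This reduces uniqueness of the projective limit to that of limits in the affine chart `z = 1`.
-/
theorem ConvergesProjectively.tendsto_div (h : ConvergesProjectively v l (nullVec θ)) :
    Tendsto (fun t => (v t).1 0 / (v t).2) l (𝓝 θ.cos) ∧
      Tendsto (fun t => (v t).1 1 / (v t).2) l (𝓝 θ.sin) := by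
  have key : ∀ ε > 0, ∀ᶠ t in l, |(v t).1 0 / (v t).2 - θ.cos| < ε ∧
      |(v t).1 1 / (v t).2 - θ.sin| < ε := fun ε hε => by
    have hsub : ∀ a b c : ℝ, |a - c * b| < ε * |c| → |a / c - b| < ε := fun a b c habc => by
      have hc : 0 < |c| := by
        by_contra! hc
        have : |c| = 0 := le_antisymm hc (abs_nonneg c)
        rw [this, mul_zero] at habc
        exact (abs_nonneg _).not_gt habc
      have hc0 : c ≠ 0 := abs_pos.1 hc
      rw [show a / c - b = (a - c * b) / c by field_simp, abs_div, div_lt_iff₀ hc]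
      exact habc
    -- An open cone around `nullVec θ`; the strict inequalities force `p.2 ≠ 0`, which excludes the
    -- origin.
    refine (h {p : Space | |p.1 0 - p.2 * θ.cos| < ε * |p.2| ∧ |p.1 1 - p.2 * θ.sin| < ε * |p.2|}
      ?_ ?_ ?_ ?_).mono fun t ht => ⟨hsub _ _ _ ht.1, hsub _ _ _ ht.2⟩
    · exact IsOpen.inter
        (isOpen_lt (f := fun p : Space => |p.1 0 - p.2 * θ.cos|) (g := fun p => ε * |p.2|)
          (by fun_prop) (by fun_prop))
        (isOpen_lt (f := fun p : Space => |p.1 1 - p.2 * θ.sin|) (g := fun p => ε * |p.2|)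
          (by fun_prop) (by fun_prop))
    · simp
    · rintro a ha u ⟨hu0, hu1⟩
      have hs : ∀ b c d : ℝ, |b - c * d| < ε * |c| → |a * b - a * c * d| < ε * |a * c| :=
        fun b c d hb => by
          rw [show a * b - a * c * d = a * (b - c * d) by ring, abs_mul, abs_mul]
          nlinarith [abs_pos.2 ha]
      exact ⟨by simpa using hs _ _ _ hu0, by simpa using hs _ _ _ hu1⟩
    · simpa [nullVec] using hε
  exact ⟨Metric.tendsto_nhds.2 fun ε hε => (key ε hε).mono fun t ht => ht.1,
    Metric.tendsto_nhds.2 fun ε hε => (key ε hε).mono fun t ht => ht.2⟩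

theorem ConvergesProjectively.angle_unique [l.NeBot] (h : ConvergesProjectively v l (nullVec θ))
    (h' : ConvergesProjectively v l (nullVec θ')) : θ = θ' := by
  have hcos := tendsto_nhds_unique h.tendsto_div.1 h'.tendsto_div.1
  have hsin := tendsto_nhds_unique h.tendsto_div.2 h'.tendsto_div.2
  induction θ using Real.Angle.induction_on
  induction θ' using Real.Angle.induction_on
  exact Real.Angle.cos_sin_inj hcos hsin

end Projective

/-! ### Coordinates adapted to a null direction. -/

theorem form_nullVec (p : Space) (θ : Real.Angle) :
    form p (nullVec θ) = p.1 0 * θ.cos + p.1 1 * θ.sin - p.2 := by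
  simp [form, nullVec]

/-- The Lorentzian square in coordinates adapted to a null direction. -/
theorem form_self_eq_nullVec (p : Space) (θ : Real.Angle) :
    form p p = (p.1 1 * θ.cos - p.1 0 * θ.sin) ^ 2 +
      form p (nullVec θ) * (form p (nullVec θ) + 2 * p.2) := by
  rw [form_nullVec, form]
  linear_combination -(p.1 0 ^ 2 + p.1 1 ^ 2) * θ.cos_sq_add_sin_sq

section Asymptotic

variable {S : Set Space} {γ : ℝ → Space} {l : Filter ℝ} {θ : Real.Angle} {w v : ℝ}

/-- Along a curve in an achronal set which is asymptotic to a future null ray of direction `θ`, the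
null height in direction `θ` tends to its supremum. -/
theorem form_nullVec_le_of_isAchronal [l.NeBot] (hS : IsAchronal S) (hγ : ∀ᶠ t in l, γ t ∈ S)
    (hz : Tendsto (fun t => (γ t).2) l atTop)
    (hw : Tendsto (fun t => form (γ t) (nullVec θ)) l (𝓝 w))
    (hv : Tendsto (fun t => (γ t).1 1 * θ.cos - (γ t).1 0 * θ.sin) l (𝓝 v)) {p : Space}
    (hp : p ∈ S) : form p (nullVec θ) ≤ w := by
  by_contra! hlt
  set W := form p (nullVec θ) with hW
  have h1 : Tendsto (fun t => form (γ t) (nullVec θ) - W) l (𝓝 (w - W)) := hw.sub_const W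
  have h2 : Tendsto (fun t => form (γ t) (nullVec θ) - W + 2 * ((γ t).2 - p.2)) l atTop :=
    h1.add_atTop ((tendsto_atTop_add_const_right l (-p.2) hz).const_mul_atTop two_pos)
  -- In adapted coordinates the square of `γ t - p` is a convergent transverse term plus this
  -- product, which tends to `-∞`: the two points become timelike separated.
  have h3 := h1.neg_mul_atTop (sub_neg.2 hlt) h2
  have h4 : Tendsto (fun t => ((γ t).1 1 * θ.cos - (γ t).1 0 * θ.sin
      - (p.1 1 * θ.cos - p.1 0 * θ.sin)) ^ 2) l
      (𝓝 ((v - (p.1 1 * θ.cos - p.1 0 * θ.sin)) ^ 2)) := (hv.sub_const _).pow 2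
  obtain ⟨t, ht, htS⟩ := (((h4.add_atBot h3).eventually_lt_atBot 0).and hγ).exists
  refine hS p hp (γ t) htS ?_
  rw [IsTimelike, form_self_eq_nullVec _ θ]
  refine lt_of_eq_of_lt ?_ ht
  rw [hW]
  simp only [form_nullVec, Prod.fst_sub, Prod.snd_sub, PiLp.sub_apply]
  ring

theorem tendsto_nullSupport [l.NeBot] (hS : IsAchronal S) (hγ : ∀ᶠ t in l, γ t ∈ S)
    (hz : Tendsto (fun t => (γ t).2) l atTop)
    (hw : Tendsto (fun t => form (γ t) (nullVec θ)) l (𝓝 w))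
    (hv : Tendsto (fun t => (γ t).1 1 * θ.cos - (γ t).1 0 * θ.sin) l (𝓝 v)) :
    Tendsto (fun t => ((form (γ t) (nullVec θ) : ℝ) : EReal)) l (𝓝 (nullSupport S θ)) ∧
      nullSupport S θ < ⊤ := by
  have hw' : Tendsto (fun t => ((form (γ t) (nullVec θ) : ℝ) : EReal)) l (𝓝 (w : EReal)) :=
    (continuous_coe_real_ereal.tendsto w).comp hw
  have heq : nullSupport S θ = w := by
    refine le_antisymm (iSup₂_le fun p hp => EReal.coe_le_coe_iff.2
      (form_nullVec_le_of_isAchronal hS hγ hz hw hv hp)) (le_of_tendsto hw' ?_)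
    filter_upwards [hγ] with t ht
    exact le_iSup₂ (f := fun p (_ : p ∈ S) => ((form p (nullVec θ) : ℝ) : EReal)) (γ t) ht
  rw [heq]
  exact ⟨hw', EReal.coe_lt_top w⟩

/-- A curve asymptotic to a future null ray tends to `-∞` in the other null directions. -/
theorem tendsto_form_nullVec_atBot (hz : Tendsto (fun t => (γ t).2) l atTop)
    (hw : Tendsto (fun t => form (γ t) (nullVec θ)) l (𝓝 w))
    (hv : Tendsto (fun t => (γ t).1 1 * θ.cos - (γ t).1 0 * θ.sin) l (𝓝 v)) {θ' : Real.Angle}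
    (hne : θ' ≠ θ) : Tendsto (fun t => form (γ t) (nullVec θ')) l atBot := by
  have hθ := θ.cos_sq_add_sin_sq
  have hθ' := θ'.cos_sq_add_sin_sq
  have hlt : θ.cos * θ'.cos + θ.sin * θ'.sin - 1 < 0 := by
    by_contra! h
    have h1 : (θ.cos - θ'.cos) ^ 2 + (θ.sin - θ'.sin) ^ 2 ≤ 0 := by nlinarith
    have hcos : θ'.cos = θ.cos := by nlinarith [sq_nonneg (θ.cos - θ'.cos), sq_nonneg (θ.sin - θ'.sin)]
    have hsin : θ'.sin = θ.sin := by nlinarith [sq_nonneg (θ.cos - θ'.cos), sq_nonneg (θ.sin - θ'.sin)]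
    induction θ using Real.Angle.induction_on
    induction θ' using Real.Angle.induction_on
    exact hne (Real.Angle.cos_sin_inj hcos hsin)
  -- The product with `nullVec θ'` is a combination of null height and transverse coordinate plus `z
  -- * (cos (θ - θ') - 1)`, and the last factor is negative.
  have h := ((hw.mul_const (θ.cos * θ'.cos + θ.sin * θ'.sin)).add
    (hv.mul_const (θ.cos * θ'.sin - θ.sin * θ'.cos))).add_atBot (hz.atTop_mul_const_of_neg hlt)
  refine h.congr fun t => ?_
  rw [form_nullVec, form_nullVec]
  linear_combination ((γ t).1 0 * θ'.cos + (γ t).1 1 * θ'.sin) * hθ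

theorem existsUnique_asymptotic_nullLine [l.NeBot]
    (hw : Tendsto (fun t => form (γ t) (nullVec θ)) l (𝓝 w))
    (hv : Tendsto (fun t => (γ t).1 1 * θ.cos - (γ t).1 0 * θ.sin) l (𝓝 v)) :
    ∃! L : AffineSubspace ℝ Space, (∃ x : Space, L = nullLine x θ) ∧ IsAsymptoticTo γ l L := by
  have hθ := θ.cos_sq_add_sin_sq
  have hc : Continuous fun a : ℝ × ℝ => ((!₂[a.1 * θ.cos - a.2 * θ.sin,
    a.1 * θ.sin + a.2 * θ.cos], 0) : Space) := by fun_prop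
  -- Sliding along the null direction to height zero leaves a horizontal vector: the pair of null
  -- height and transverse coordinate, rotated by `θ`.
  refine existsUnique_isAsymptoticTo (ρ := fun t => (γ t).2)
    (((hc.tendsto (w, v)).comp (hw.prodMk_nhds hv)).congr fun t => ?_)
  refine Prod.ext ?_ (by simp [nullVec])
  ext i
  fin_cases i
  · simp [form_nullVec]
    simp [nullVec]
    linear_combination ((γ t).1 0) * hθ
  · simp [form_nullVec]
    simp [nullVec]
    linear_combination ((γ t).1 1) * hθ

end Asymptotic

end Minkowski

/-! ### The theorem on proper geodesics of finite length. -/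

theorem mainTheorem5 (S : Set Minkowski.Space) (hS : Minkowski.IsConvexEntireSpacelike S)
    (T : EReal) (hT : 0 < T) (γ : ℝ → Minkowski.Space) (hγ : Minkowski.IsGeodesic S T γ)
    (hproper : IsProperMap (hγ.mapsTo.restrict γ (Minkowski.ray T) S))
    (hlength : Minkowski.length T γ < ⊤) :
    ∃ θ₀ : Real.Angle,
      (Minkowski.ConvergesProjectively (Minkowski.velocity γ T) (Minkowski.toEnd T)
          (Minkowski.nullVec θ₀) ∧
        ∀ θ : Real.Angle,
          Minkowski.ConvergesProjectively (Minkowski.velocity γ T) (Minkowski.toEnd T)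
            (Minkowski.nullVec θ) → θ = θ₀) ∧
      (∃! L : AffineSubspace ℝ Minkowski.Space,
        (∃ x : Minkowski.Space, L = Minkowski.nullLine x θ₀) ∧
          Minkowski.IsAsymptoticTo γ (Minkowski.toEnd T) L) ∧
      (Tendsto (fun t => ((Minkowski.form (γ t) (Minkowski.nullVec θ₀) : ℝ) : EReal))
          (Minkowski.toEnd T) (𝓝 (Minkowski.nullSupport S θ₀)) ∧
        Minkowski.nullSupport S θ₀ < ⊤) ∧
      ∀ θ : Real.Angle, θ ≠ θ₀ →
        Tendsto (fun t => Minkowski.form (γ t) (Minkowski.nullVec θ))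
          (Minkowski.toEnd T) atBot := by
  open Minkowski in
  obtain ⟨f, hf, hmem, hd, hf1⟩ := hS.exists_graph
  have hclosed : IsClosed S := by
    have : S = {p | p.2 = f p.1} := Set.ext hmem
    rw [this]
    exact isClosed_eq continuous_snd (hd.continuous.comp continuous_fst)
  have hnorm := tendsto_norm_of_isProperMap hclosed hT hγ.mapsTo hproper
  obtain ⟨c, hspeed⟩ := hγ.exists_form_velocity_eq hT
  obtain ⟨t₀, ht₀, ht₀T⟩ := EReal.exists_between_coe_real hT
  have ht₀' : t₀ ∈ openRay T := ⟨by exact_mod_cast ht₀, ht₀T⟩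
  have hsub : ∀ t ∈ openRay T, 0 ≤ form (velocity γ T t) (velocity γ T t) ∧
      (form (velocity γ T t) (velocity γ T t) = 0 → velocity γ T t = 0) := fun t ht =>
    form_self_nonneg_of_snd_eq (hf1 (γ t).1) ((hγ.isTangent_velocity ht).snd_eq hmem hd)
  have hev : ∀ᶠ t in toEnd T, t ∈ openRay T := by
    filter_upwards [eventually_lt_toEnd (t := 0) (by exact_mod_cast hT), eventually_coe_lt_toEnd]
      with t h0 h1 using ⟨h0, h1⟩
  have hneBot : (toEnd T).NeBot := toEnd_neBot hT
  have hc : 0 < c := by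
    -- At zero speed the spacelike or zero velocity vanishes, so `γ` would be constant on `(0, T)`,
    -- although its norm tends to infinity.
    refine lt_of_le_of_ne (hspeed t₀ ht₀' ▸ (hsub t₀ ht₀').1) fun h0 => ?_
    obtain ⟨b, hb⟩ := isOpen_openRay.exists_is_const_of_deriv_eq_zero (f := γ)
      (convex_openRay (T := T)).isPreconnected
      (fun t ht => (hγ.hasDerivAt ht).differentiableAt.differentiableWithinAt) (fun t ht => by
        rw [(hγ.hasDerivAt ht).deriv]
        exact (hsub t ht).2 ((hspeed t ht).trans h0.symm))
    obtain ⟨t, ht, htb⟩ := (hev.and (hnorm.eventually_gt_atTop ‖b‖)).exists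
    rw [hb t ht] at htb
    exact lt_irrefl _ htb
  lift T to ℝ using ⟨ne_top_of_length_lt_top hc hspeed hlength, ne_bot_of_gt hT⟩ with τ
  have hτ : 0 < τ := by exact_mod_cast hT
  have hray : ∀ t ∈ Ioo 0 τ, t ∈ openRay (τ : EReal) := fun t ht => (openRay_coe τ).symm ▸ ht
  have hγ' : IsFutureAccelerated τ c (fun t => (γ t).1 0) (fun t => (γ t).1 1) (fun t => (γ t).2)
      (fun t => (velocity γ τ t).1 0) (fun t => (velocity γ τ t).1 1) (fun t => (velocity γ τ t).2)
      (fun t => (acceleration γ τ t).1 0) (fun t => (acceleration γ τ t).1 1)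
      (fun t => (acceleration γ τ t).2) :=
    { hx := fun t ht => (hγ.hasDerivAt (hray t ht)).space_coord 0
      hy := fun t ht => (hγ.hasDerivAt (hray t ht)).space_coord 1
      hz := fun t ht => (hγ.hasDerivAt (hray t ht)).space_snd
      hp := fun t ht => (hγ.hasDerivAt_velocity hT (hray t ht)).space_coord 0
      hq := fun t ht => (hγ.hasDerivAt_velocity hT (hray t ht)).space_coord 1
      hr := fun t ht => (hγ.hasDerivAt_velocity hT (hray t ht)).space_snd
      nonneg := fun t ht => (hγ.acceleration_causal hT hf hmem hd hf1 (hray t ht)).1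
      cone := fun t ht => (hγ.acceleration_causal hT hf hmem hd hf1 (hray t ht)).2
      speed := fun t ht => by
        rw [← hspeed t (hray t ht), form]; ring }
  rw [toEnd_coe] at *
  obtain ⟨θ, w, v, hr, hz, hcos, hsin, hw, hv⟩ := hγ'.exists_angle_asymptotics hτ hc
    (tendsto_atTop_mono (fun t => norm_sq_le (γ t)) ((tendsto_pow_atTop two_ne_zero).comp hnorm))
  simp only [← form_nullVec] at hw
  have hconv := convergesProjectively_nullVec (hr.eventually_gt_atTop 0) hcos hsin
  have hγS : ∀ᶠ t in 𝓝[<] τ, γ t ∈ S := hev.mono fun t ht => hγ.mapsTo ⟨ht.1.le, ht.2⟩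
  exact ⟨θ, ⟨hconv, fun θ' h => h.angle_unique hconv⟩, existsUnique_asymptotic_nullLine hw hv,
    tendsto_nullSupport hS.isEntire.1 hγS hz hw hv,
    fun θ' hne => tendsto_form_nullVec_atBot hz hw hv hne⟩
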